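/- Let $\Omega\subset\mathbb C^n$ be a bounded domain. For $1\le p<\infty$ let $A^p(\Omega)$ be the space of holomorphic functions $f$ on $\Omega$ with $\|f\|_p:=\bigl(\int_\Omega|f|^p\bigr)^{1/p}<\infty$ (Lebesgue measure). For $z\in\Omega$ put $$K_p(z):=\max\{|f(z)|^p : f\in A^p(\Omega),\ \|f\|_p=1\},$$ let $m_p(\cdot,z)$ be the unique minimizer of $\|f\|_p$ among all $f\in A^p(\Omega)$ with $f(z)=1$, and let $K_p(\zeta,z):=m_p(\zeta,z)\,K_p(z)$ for $\zeta,z\in\Omega$ (the off-diagonal $p$-Bergman kernel). For $\alpha>0$ and a function $u:\Omega\to\mathbb C$, write $u\in C(\overline\Omega)$ if $u$ extends to a continuous function on $\overline\Omega$; $u\in C^\alpha(\overline\Omega)$ if $u$ extends to a function $v$ on $\overline\Omega$ with $|v(x)-v(y)|\le C|x-y|^\alpha$ for all $x,y\in\overline\Omega$ and some constant $C$; and $u\in C^\alpha_{\rm loc}(\Omega)$ if every point of $\Omega$ has a neighbourhood in $\Omega$ on which $u$ satisfies such an inequality. **Theorem.** Let $\Omega\subset\mathbb C^n$ be a bounded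 complete Reinhardt domain (that is, $z\in\Omega$ and $|w_j|\le|z_j|$ for all $j$ imply $w\in\Omega$) with $C^\infty$ boundary, and suppose that $K_2(\zeta,z)=0$ for some $\zeta,z\in\Omega$. Then: 1. For each $\alpha>0$ there exist an integer $k\ge1$ and a point $z\in\Omega$ such that $K_{2k}(\cdot,z)\notin C^\alpha(\overline\Omega)$. 2. For each $\alpha>0$ there exists an integer $k\ge1$ such that either $K_{2k}(\cdot,z)\notin C(\overline\Omega)$ for some $z\in\Omega$, or $K_{2k}(\cdot,z)\in C(\overline\Omega)$ for every $z\in\Omega$ and, with $K_{2k}(\zeta,z)$ for $\zeta\in\partial\Omega$ denoting the value at $\zeta$ of the continuous extension of $K_{2k}(\cdot,z)$, $K_{2k}(\zeta,\cdot)\notin C^\alpha_{\rm loc}(\Omega)$ for some $\zeta\in\partial\Omega$. -/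

import Mathlib

open Set Filter Topology MeasureTheory
open scoped NNReal ContDiff

/-! Complex `n`-space is `Fin n → ℂ`, with its product (that is, Lebesgue) measure. Its norm is the
maximum norm, which is equivalent to the Euclidean one; boundedness, smoothness of the boundary,
holomorphy, and membership in the Hölder classes below do not depend on this choice. -/

/-- `Ω` is a complete Reinhardt set (with centre `0`): with each point `z` it contains the closed
polydisc of all `w` with `|w j| ≤ |z j|` for all `j`. -/
def IsCompleteReinhardt {n : ℕ} (Ω : Set (Fin n → ℂ)) : Prop :=
  ∀ z ∈ Ω, ∀ w : Fin n → ℂ, (∀ j, ‖w j‖ ≤ ‖z j‖) → w ∈ Ω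

/-- `Ω` has smooth (`C^∞`) boundary: near each boundary point it is the sublevel set `{ρ < 0}` of a
smooth real function `ρ` without critical points. -/
def HasSmoothBoundary {n : ℕ} (Ω : Set (Fin n → ℂ)) : Prop :=
  ∀ x ∈ frontier Ω, ∃ (U : Set (Fin n → ℂ)) (ρ : (Fin n → ℂ) → ℝ),
    IsOpen U ∧ x ∈ U ∧ ContDiffOn ℝ ∞ ρ U ∧ (∀ y ∈ U, fderiv ℝ ρ y ≠ 0) ∧
      Ω ∩ U = {y ∈ U | ρ y < 0}

/-- `f` restricted to the open set `Ω` belongs to the `p`-Bergman space `A^p(Ω)`: it is holomorphic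
on `Ω` and `|f|^p` is integrable over `Ω`. -/
def MemBergman {n : ℕ} (p : ℝ) (Ω : Set (Fin n → ℂ)) (f : (Fin n → ℂ) → ℂ) : Prop :=
  DifferentiableOn ℂ f Ω ∧ IntegrableOn (fun ζ => ‖f ζ‖ ^ p) Ω

/-- The norm `‖f‖_p = (∫_Ω |f|^p)^(1/p)` of `A^p(Ω)`. -/
noncomputable def bergmanNorm {n : ℕ} (p : ℝ) (Ω : Set (Fin n → ℂ)) (f : (Fin n → ℂ) → ℂ) : ℝ :=
  (∫ ζ in Ω, ‖f ζ‖ ^ p) ^ (1 / p)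

/-- The diagonal `p`-Bergman kernel `K_p(z) = max {|f(z)|^p : f ∈ A^p(Ω), ‖f‖_p = 1}`. -/
noncomputable def bergmanDiag {n : ℕ} (p : ℝ) (Ω : Set (Fin n → ℂ)) (z : Fin n → ℂ) : ℝ :=
  sSup {t : ℝ | ∃ f, MemBergman p Ω f ∧ bergmanNorm p Ω f = 1 ∧ t = ‖f z‖ ^ p}

/-- `f` is a minimizer of `‖f‖_p` among all `f ∈ A^p(Ω)` with `f(z) = 1`. -/
def IsBergmanMinimizer {n : ℕ} (p : ℝ) (Ω : Set (Fin n → ℂ)) (z : Fin n → ℂ)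
    (f : (Fin n → ℂ) → ℂ) : Prop :=
  MemBergman p Ω f ∧ f z = 1 ∧
    ∀ g, MemBergman p Ω g → g z = 1 → bergmanNorm p Ω f ≤ bergmanNorm p Ω g

open Classical in
/-- The function `ζ ↦ m_p(ζ, z)`: the minimizer of `‖f‖_p` among all `f ∈ A^p(Ω)` with `f(z) = 1`.
For a bounded domain `Ω`, a point `z ∈ Ω` and `1 ≤ p < ∞`, the minimizer exists and its restriction
to `Ω` is unique; only the values at `ζ ∈ Ω` are meaningful. -/
noncomputable def bergmanMin {n : ℕ} (p : ℝ) (Ω : Set (Fin n → ℂ)) (ζ z : Fin n → ℂ) : ℂ :=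
  if h : ∃ f, IsBergmanMinimizer p Ω z f then h.choose ζ else 0

/-- The off-diagonal `p`-Bergman kernel `K_p(ζ, z) = m_p(ζ, z) K_p(z)`, for `ζ, z ∈ Ω`. -/
noncomputable def bergmanKernel {n : ℕ} (p : ℝ) (Ω : Set (Fin n → ℂ)) (ζ z : Fin n → ℂ) : ℂ :=
  bergmanMin p Ω ζ z * (bergmanDiag p Ω z : ℂ)

/-- `v` is a continuous function on `closure Ω` that extends `u : Ω → ℂ`. (Such a `v` is unique on
`closure Ω`; the values of `u` outside `Ω` do not matter.) -/
def IsContExtension {n : ℕ} (Ω : Set (Fin n → ℂ)) (u v : (Fin n → ℂ) → ℂ) : Prop :=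
  ContinuousOn v (closure Ω) ∧ EqOn v u Ω

/-- `u : Ω → ℂ` belongs to `C(closure Ω)`. -/
def MemContClosure {n : ℕ} (Ω : Set (Fin n → ℂ)) (u : (Fin n → ℂ) → ℂ) : Prop :=
  ∃ v, IsContExtension Ω u v

/-- `u : Ω → ℂ` belongs to `C^α(closure Ω)`, that is, it extends to a function on `closure Ω` that
is Hölder continuous with exponent `α`. -/
def MemHolderClosure {n : ℕ} (α : ℝ≥0) (Ω : Set (Fin n → ℂ)) (u : (Fin n → ℂ) → ℂ) : Prop :=
  ∃ v, EqOn v u Ω ∧ ∃ C : ℝ≥0, HolderOnWith C α v (closure Ω)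

/-- `u : Ω → ℂ` belongs to `C^α_loc(Ω)`: each point of the open set `Ω` has a neighbourhood in `Ω`
on which `u` is Hölder continuous with exponent `α`. -/
def MemHolderLoc {n : ℕ} (α : ℝ≥0) (Ω : Set (Fin n → ℂ)) (u : (Fin n → ℂ) → ℂ) : Prop :=
  ∀ x ∈ Ω, ∃ U ∈ 𝓝[Ω] x, ∃ C : ℝ≥0, HolderOnWith C α u U

/-!
Let `Ω` be a bounded complete Reinhardt domain and let `κ = K₂(·, z₁)` be the reproducing kernel of
`A²(Ω)` at a point `z₁` for which it has a zero in `Ω`. The theorem holds because a zero of `K₂`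
can be pushed to the boundary, where the minimizer `m_{2k}` is, in modulus, a `k`-th root of a
function with a zero of finite order.

* Rotation invariance of `Ω` makes the dilation `f ↦ f(t ·)`, `0 < t ≤ 1`, self-adjoint on
  `A²(Ω)`, so `κ(t ·)` is the reproducing kernel at `t z₁` (`IsReproducingKernel.comp_smul`). This
  function is holomorphic past the closure of `Ω` when `t < 1`, and `κ 0 ≠ 0`.
* Hence there is a smallest `t ∈ (0, 1)` such that `κ(t ·)` vanishes somewhere on the closure of
  `Ω`; it vanishes at a boundary point `ζ₀`, and `κ(s ·)` is zero-free on `Ω` for `s ≤ t`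
  (`exists_first_zero`).
* If the reproducing kernel `h` at `z` is zero-free, it has a holomorphic `k`-th root on the
  star-shaped set `Ω`, and since `f ∈ A^{2k}` implies `f ^ k ∈ A²`, minimality in `A²` gives
  `m_{2k}(·, z) ^ k = h / h z` (`IsReproducingKernel.bergmanMin_pow`). So `|K_{2k}(ζ, s z₁)| ^ k` is
  a positive factor times `|κ(s ζ)|` for `s ≤ t`, on `Ω` and on its closure whenever `K_{2k}` has a
  continuous extension (`norm_pow_eq_of_isContExtension`).
* The function `H(c) = κ(c ζ₀)` is holomorphic on the unit disc, `H 0 ≠ 0` and `H t = 0`, so the zero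
  has a finite order `N`. An `α`-Hölder bound on `K_{2k}(·, t z₁)` near `ζ₀`, or on `K_{2k}(ζ₀, ·)`
  near `t z₁`, yields `|H s| ≤ C (t - s) ^ (α k)` for `s` below `t`, which is impossible for
  `α k > N` (`exists_not_eventually_le`).

The existence of reproducing kernels rests on the closedness of `A²(Ω)` in `L²(Ω)`, which follows
from the mean value property on balls (polydiscs) and Cauchy's estimate.
-/

section

/-! ### Circle averages and the mean value property -/

/-- Self-adjointness of the dilation by `t` with respect to the pairing of boundary values on the
unit circle. Both sides are circle averages, over `|w| = 1` and `|w| = 1 / t`, of one function that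
is holomorphic on the annulus in between. -/
theorem circleAverage_dilate {φ ψ : ℂ → ℂ} {t : ℝ} (ht : 0 < t) (ht1 : t ≤ 1)
    (hφ : DiffContOnCl ℂ φ (Metric.ball 0 1)) (hψ : DiffContOnCl ℂ ψ (Metric.ball 0 1)) :
    Real.circleAverage (fun w => φ (t * w) * (starRingEnd ℂ) (ψ w)) 0 1 =
      Real.circleAverage (fun w => φ w * (starRingEnd ℂ) (ψ (t * w))) 0 1 := by
  set Φ : ℂ → ℂ := fun w =>
    φ (t * w) * (starRingEnd ℂ) (ψ ((starRingEnd ℂ) w⁻¹)) with hΦ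
  have ht1' : 1 ≤ t⁻¹ := (one_le_inv₀ ht).2 ht1
  have hφc : ContinuousOn φ (Metric.closedBall 0 1) := hφ.continuousOn_ball
  have hψc : ContinuousOn ψ (Metric.closedBall 0 1) := hψ.continuousOn_ball
  have hnt : ∀ w : ℂ, ‖(t : ℂ) * w‖ = t * ‖w‖ := fun w => by
    rw [norm_mul, Complex.norm_real, Real.norm_of_nonneg ht.le]
  have hnc : ∀ w : ℂ, ‖(starRingEnd ℂ) w⁻¹‖ = ‖w‖⁻¹ := fun w => by
    rw [RCLike.norm_conj, norm_inv]
  -- `Φ` is holomorphic on the annulus `1 < |w| < 1 / t`, so its circle averages on both boundary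
  -- circles agree.
  have key : Real.circleAverage Φ 0 t⁻¹ = Real.circleAverage Φ 0 1 := by
    rw [Real.circleAverage_eq_circleIntegral (inv_pos.2 ht).ne',
      Real.circleAverage_eq_circleIntegral one_ne_zero]
    congr 1
    refine Complex.circleIntegral_sub_center_inv_smul_eq_of_differentiable_on_annulus_off_countable
      one_pos ht1' countable_empty ?_ ?_
    · refine ContinuousOn.mul (hφc.comp (by fun_prop) ?_) ?_
      · rintro w ⟨hw, -⟩
        rw [mem_closedBall_zero_iff] at hw ⊢
        rw [hnt]
        calc t * ‖w‖ ≤ t * t⁻¹ := by gcongr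
          _ = 1 := mul_inv_cancel₀ ht.ne'
      · refine Complex.continuous_conj.comp_continuousOn (hψc.comp
          (Complex.continuous_conj.comp_continuousOn (continuousOn_inv₀.mono ?_)) ?_)
        · rintro w ⟨-, hw⟩ rfl
          simp at hw
        · rintro w ⟨-, hw⟩
          simp only [Metric.mem_ball, dist_zero_right, not_lt] at hw
          rw [mem_closedBall_zero_iff]
          simp only [hnc]
          exact inv_le_one_of_one_le₀ hw
    · rintro w ⟨⟨hw, hw'⟩, -⟩
      simp only [Metric.mem_ball, dist_zero_right, Metric.mem_closedBall, not_le] at hw hw'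
      have hw0 : w ≠ 0 := by rintro rfl; simp at hw'; linarith
      refine DifferentiableAt.mul ?_ ?_
      · refine DifferentiableAt.comp w (hφ.differentiableAt Metric.isOpen_ball ?_) (by fun_prop)
        rw [mem_ball_zero_iff, hnt]
        calc t * ‖w‖ < t * t⁻¹ := by gcongr
          _ = 1 := mul_inv_cancel₀ ht.ne'
      · have h1 : DifferentiableAt ℂ ((starRingEnd ℂ) ∘ ψ ∘ (starRingEnd ℂ)) (w⁻¹) := by
          rw [differentiableAt_conj_conj_iff]
          refine hψ.differentiableAt Metric.isOpen_ball ?_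
          rw [mem_ball_zero_iff, hnc]
          exact inv_lt_one_of_one_lt₀ hw'
        exact h1.comp w (differentiableAt_inv hw0)
  have hmap : ∀ θ, ‖circleMap 0 1 θ‖ = 1 := fun θ => by simp
  have e1 : Real.circleAverage (fun w => φ (t * w) * (starRingEnd ℂ) (ψ w)) 0 1 =
      Real.circleAverage Φ 0 1 := by
    refine Real.circleAverage_congr_sphere fun w hw => ?_
    have hw1 : ‖w‖ = 1 := by simpa using hw
    simp only [hΦ]
    rw [Complex.inv_eq_conj hw1, Complex.conj_conj]
  have e2 : Real.circleAverage Φ 0 t⁻¹ =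
      Real.circleAverage (fun w => φ w * (starRingEnd ℂ) (ψ (t * w))) 0 1 := by
    simp only [Real.circleAverage_def]
    congr 1
    refine intervalIntegral.integral_congr fun θ _ => ?_
    have htc : (t : ℂ) ≠ 0 := by exact_mod_cast ht.ne'
    have h2 : circleMap 0 t⁻¹ θ = (t : ℂ)⁻¹ * circleMap 0 1 θ := by simp [circleMap]
    have h3 : (starRingEnd ℂ) (circleMap 0 t⁻¹ θ)⁻¹ = t * circleMap 0 1 θ := by
      rw [h2, mul_inv, inv_inv, map_mul, Complex.conj_ofReal,
        Complex.inv_eq_conj (hmap θ), Complex.conj_conj]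
    simp only [hΦ]
    rw [h3, h2, mul_inv_cancel_left₀ htc]
  rw [e1, ← key, e2]

theorem measurePreserving_circle_smul {n : ℕ} {c : ℂ} (hc : ‖c‖ = 1) :
    MeasurePreserving (fun ζ : Fin n → ℂ => c • ζ) := by
  have h : MeasurePreserving (fun z : ℂ => c * z) := by
    have := (rotation ⟨c, by simpa [Submonoid.unitSphere] using hc⟩).measurePreserving
    exact this
  exact volume_preserving_pi (fun _ : Fin n => h)

theorem setIntegral_comp_circle_smul {n : ℕ} {D : Set (Fin n → ℂ)}
    (hcirc : ∀ c : ℂ, ‖c‖ = 1 → ∀ ζ ∈ D, c • ζ ∈ D) {V : Type*} [NormedAddCommGroup V]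
    [NormedSpace ℝ V] (F : (Fin n → ℂ) → V) {c : ℂ} (hc : ‖c‖ = 1) :
    ∫ ζ in D, F (c • ζ) = ∫ ζ in D, F ζ := by
  have hc0 : c ≠ 0 := by rintro rfl; simp at hc
  have hpre : (fun ζ : Fin n → ℂ => c • ζ) ⁻¹' D = D := by
    ext ζ
    refine ⟨fun h => ?_, hcirc c hc ζ⟩
    have := hcirc c⁻¹ (by simp [hc]) _ h
    simpa [smul_smul, hc0] using this
  have := (measurePreserving_circle_smul (n := n) hc).setIntegral_preimage_emb
    (Homeomorph.smulOfNeZero c hc0).measurableEmbedding F D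
  rwa [hpre] at this

/-- The integral over a circular set does not change when the integrand is averaged over the circle
action. -/
theorem setIntegral_eq_circleAverage {n : ℕ} {D : Set (Fin n → ℂ)} (hD : IsOpen D)
    (hcirc : ∀ c : ℂ, ‖c‖ = 1 → ∀ ζ ∈ D, c • ζ ∈ D) {F : (Fin n → ℂ) → ℂ}
    (hFc : ContinuousOn F D) (hF : IntegrableOn F D) :
    ∫ ζ in D, F ζ = ∫ ζ in D, Real.circleAverage (fun c => F (c • ζ)) 0 1 := by
  have hint : Integrable (Function.uncurry fun (θ : ℝ) (ζ : Fin n → ℂ) => F (circleMap 0 1 θ • ζ))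
      ((volume.restrict (uIoc 0 (2 * Real.pi))).prod (volume.restrict D)) := by
    have hmeas : AEStronglyMeasurable
        (Function.uncurry fun (θ : ℝ) (ζ : Fin n → ℂ) => F (circleMap 0 1 θ • ζ))
        ((volume.restrict (uIoc 0 (2 * Real.pi))).prod (volume.restrict D)) := by
      rw [Measure.prod_restrict]
      refine ContinuousOn.aestronglyMeasurable ?_ (measurableSet_uIoc.prod hD.measurableSet)
      refine hFc.comp (f := fun p : ℝ × (Fin n → ℂ) => circleMap 0 1 p.1 • p.2)
        (((continuous_circleMap 0 1).comp continuous_fst).smul continuous_snd).continuousOn ?_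
      rintro ⟨θ, ζ⟩ ⟨-, hζ⟩
      exact hcirc _ (by simp) _ hζ
    rw [integrable_prod_iff hmeas]
    refine ⟨ae_of_all _ fun θ => ?_, ?_⟩
    · have hθ : ‖circleMap 0 1 θ‖ = 1 := by simp
      have hc0 : circleMap 0 1 θ ≠ 0 := by intro h; simp [h] at hθ
      have hpre : (fun ζ : Fin n → ℂ => circleMap 0 1 θ • ζ) ⁻¹' D = D := by
        ext ζ
        refine ⟨fun h => ?_, hcirc _ hθ ζ⟩
        have := hcirc (circleMap 0 1 θ)⁻¹ (by simp) _ h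
        simpa only [smul_smul, inv_mul_cancel₀ hc0, one_smul] using this
      have := ((measurePreserving_circle_smul (n := n) hθ).integrableOn_comp_preimage
        (Homeomorph.smulOfNeZero _ hc0).measurableEmbedding (f := F) (s := D)).2 hF
      rwa [hpre] at this
    · have : (fun θ : ℝ => ∫ ζ in D, ‖F (circleMap 0 1 θ • ζ)‖) = fun _ => ∫ ζ in D, ‖F ζ‖ := by
        ext θ
        exact setIntegral_comp_circle_smul hcirc (fun ζ => ‖F ζ‖) (by simp)
      simp only [Function.uncurry_apply_pair, this]
      exact intervalIntegrable_const.def'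
  have h1 := intervalIntegral_integral_swap hint
  simp only [Real.circleAverage_def]
  rw [integral_smul, ← h1]
  have h2 : ∀ θ : ℝ, ∫ ζ in D, F (circleMap 0 1 θ • ζ) = ∫ ζ in D, F ζ := fun θ =>
    setIntegral_comp_circle_smul hcirc F (by simp)
  simp only [h2, intervalIntegral.integral_const, sub_zero]
  rw [smul_smul, inv_mul_cancel₀ (by positivity), one_smul]

/-- The restriction of a holomorphic function to the complex line through the origin and a point of
a balanced open set is holomorphic on the closed unit disc. -/
theorem diffContOnCl_comp_smul {n : ℕ} {D : Set (Fin n → ℂ)} (hD : IsOpen D)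
    (hbal : Balanced ℂ D) {f : (Fin n → ℂ) → ℂ} (hf : DifferentiableOn ℂ f D) {ζ : Fin n → ℂ}
    (hζ : ζ ∈ D) : DiffContOnCl ℂ (fun c : ℂ => f (c • ζ)) (Metric.ball 0 1) := by
  refine DifferentiableOn.diffContOnCl fun c hc => ?_
  have hc1 : ‖c‖ ≤ 1 := by
    simpa using Metric.closure_ball_subset_closedBall hc
  have h : DifferentiableAt ℂ f (c • ζ) := hf.differentiableAt (hD.mem_nhds (hbal.smul_mem hc1 hζ))
  exact (h.comp c (f := fun c : ℂ => c • ζ) (by fun_prop)).differentiableWithinAt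

/-- Mean value property over a balanced open set. -/
theorem Balanced.setIntegral_eq {n : ℕ} {D : Set (Fin n → ℂ)} (hD : IsOpen D)
    (hbal : Balanced ℂ D) {f : (Fin n → ℂ) → ℂ} (hf : DifferentiableOn ℂ f D)
    (hint : IntegrableOn f D) : ∫ ζ in D, f ζ = volume.real D * f 0 := by
  rw [setIntegral_eq_circleAverage hD (fun c hc ζ hζ => hbal.smul_mem hc.le hζ) hf.continuousOn
    hint]
  have h : ∀ ζ ∈ D, Real.circleAverage (fun c => f (c • ζ)) 0 1 = f 0 := fun ζ hζ => by
    have := (show DiffContOnCl ℂ (fun c : ℂ => f (c • ζ)) (Metric.ball 0 |1|) by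
      simpa using diffContOnCl_comp_smul hD hbal hf hζ).circleAverage
    simpa using this
  rw [setIntegral_congr_fun hD.measurableSet h]
  simp

theorem setIntegral_ball_eq {n : ℕ} {w : Fin n → ℂ} {r : ℝ} {f : (Fin n → ℂ) → ℂ}
    (hf : DifferentiableOn ℂ f (Metric.ball w r)) (hint : IntegrableOn f (Metric.ball w r)) :
    ∫ ζ in Metric.ball w r, f ζ = volume.real (Metric.ball w r) * f w := by
  have hpre : (fun ζ => w + ζ) ⁻¹' Metric.ball w r = Metric.ball 0 r := by ext; simp
  have hmp := measurePreserving_add_left (volume : Measure (Fin n → ℂ)) w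
  have hemb := (Homeomorph.addLeft w).measurableEmbedding
  have h1 := hmp.setIntegral_preimage_emb hemb f (Metric.ball w r)
  have h2 := (hmp.integrableOn_comp_preimage hemb (f := f) (s := Metric.ball w r)).2 hint
  have h3 := hmp.measureReal_preimage (s := Metric.ball w r) measurableSet_ball.nullMeasurableSet
  rw [hpre] at h1 h2 h3
  rw [← h1, ← h3, Balanced.setIntegral_eq (f := fun ζ => f (w + ζ)) Metric.isOpen_ball
    (balanced_ball_zero) ?_ h2]
  · simp
  · refine hf.comp (by fun_prop) fun ζ hζ => ?_
    simpa using hζ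

/-- The point evaluation bound for `A²`, from the mean value property of `f ^ 2`. -/
theorem norm_sq_le_setIntegral {n : ℕ} {Ω : Set (Fin n → ℂ)} {w : Fin n → ℂ} {r : ℝ} (hr : 0 < r)
    (hw : Metric.ball w r ⊆ Ω) {f : (Fin n → ℂ) → ℂ} (hf : DifferentiableOn ℂ f Ω)
    (hint : IntegrableOn (fun ζ => ‖f ζ‖ ^ 2) Ω) :
    ‖f w‖ ^ 2 ≤ (volume.real (Metric.ball w r))⁻¹ * ∫ ζ in Ω, ‖f ζ‖ ^ 2 := by
  have hpos : 0 < volume.real (Metric.ball w r) :=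
    ENNReal.toReal_pos (Metric.measure_ball_pos _ _ hr).ne' measure_ball_lt_top.ne
  have hd : DifferentiableOn ℂ (fun ζ => f ζ ^ 2) (Metric.ball w r) := (hf.mono hw).pow 2
  have hi : IntegrableOn (fun ζ => f ζ ^ 2) (Metric.ball w r) := by
    refine (hint.mono_set hw).mono' (hd.continuousOn.aestronglyMeasurable measurableSet_ball) ?_
    exact ae_of_all _ fun ζ => by simp
  have h := setIntegral_ball_eq hd hi
  rw [le_inv_mul_iff₀ hpos]
  calc volume.real (Metric.ball w r) * ‖f w‖ ^ 2 = ‖∫ ζ in Metric.ball w r, f ζ ^ 2‖ := by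
        rw [h]; simp [abs_of_pos hpos]
    _ ≤ ∫ ζ in Metric.ball w r, ‖f ζ ^ 2‖ := norm_integral_le_integral_norm _
    _ = ∫ ζ in Metric.ball w r, ‖f ζ‖ ^ 2 := by simp
    _ ≤ ∫ ζ in Ω, ‖f ζ‖ ^ 2 :=
        setIntegral_mono_set hint (ae_of_all _ fun ζ => by positivity) hw.eventuallyLE

/-! ### Holomorphic functions of several variables -/

/-- Cauchy's estimate for the derivative of a holomorphic function of several variables, obtained on
complex lines. The radius `r / 2` keeps the discs inside the open ball. -/
theorem norm_fderiv_le_of_forall_ball {V : Type*} [NormedAddCommGroup V] [NormedSpace ℂ V]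
    {f : V → ℂ} {w : V} {r M : ℝ} (hr : 0 < r) (hf : DifferentiableOn ℂ f (Metric.ball w r))
    (hM : ∀ x ∈ Metric.ball w r, ‖f x‖ ≤ M) : ‖fderiv ℂ f w‖ ≤ M / (r / 2) := by
  have hM0 : 0 ≤ M := (norm_nonneg _).trans (hM w (Metric.mem_ball_self hr))
  refine ContinuousLinearMap.opNorm_le_bound _ (by positivity) fun v => ?_
  rcases eq_or_ne v 0 with rfl | hv
  · simp
  have hv' : 0 < ‖v‖ := norm_pos_iff.2 hv
  set R := r / 2 / ‖v‖ with hR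
  have hR0 : 0 < R := by positivity
  have hmem : ∀ c ∈ Metric.closedBall (0 : ℂ) R, w + c • v ∈ Metric.ball w r := fun c hc => by
    rw [mem_closedBall_zero_iff] at hc
    rw [mem_ball_iff_norm, add_sub_cancel_left, norm_smul]
    calc ‖c‖ * ‖v‖ ≤ R * ‖v‖ := by gcongr
      _ = r / 2 := by rw [hR]; field_simp
      _ < r := by linarith
  have hdiff : ∀ c ∈ Metric.closedBall (0 : ℂ) R,
      HasDerivAt (fun c : ℂ => f (w + c • v)) (fderiv ℂ f (w + c • v) v) c := fun c hc => by
    have h1 : HasDerivAt (fun c : ℂ => w + c • v) v c := by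
      simpa using ((hasDerivAt_id c).smul_const v).const_add w
    exact (hf.differentiableAt (Metric.isOpen_ball.mem_nhds (hmem c hc))).hasFDerivAt.comp_hasDerivAt
      c h1
  have h2 := Complex.norm_deriv_le_of_forall_mem_sphere_norm_le (f := fun c : ℂ => f (w + c • v))
    (c := 0) (C := M) hR0
    (DifferentiableOn.diffContOnCl fun c hc => (hdiff c
      (Metric.closure_ball_subset_closedBall hc)).differentiableAt.differentiableWithinAt)
    (fun c hc => hM _ (hmem c (Metric.sphere_subset_closedBall hc)))
  rw [(hdiff 0 (Metric.mem_closedBall_self hR0.le)).deriv] at h2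
  simp only [zero_smul, add_zero] at h2
  refine h2.trans_eq ?_
  rw [hR]
  field_simp

/-- Weierstrass' convergence theorem in several variables. -/
theorem differentiableAt_of_uniformCauchySeqOn {V : Type*} [NormedAddCommGroup V]
    [NormedSpace ℂ V] {f : ℕ → V → ℂ} {g : V → ℂ} {z : V} {r : ℝ} (hr : 0 < r)
    (hf : ∀ j, DifferentiableOn ℂ (f j) (Metric.ball z r))
    (hc : UniformCauchySeqOn f atTop (Metric.ball z r))
    (hg : ∀ w ∈ Metric.ball z r, Tendsto (fun j => f j w) atTop (𝓝 (g w))) :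
    DifferentiableAt ℂ g z := by
  have hsub : ∀ w ∈ Metric.ball z (r / 2), Metric.ball w (r / 2) ⊆ Metric.ball z r :=
    fun w hw => Metric.ball_subset_ball' (by rw [Metric.mem_ball] at hw; linarith)
  have hc' : UniformCauchySeqOn (fun j w => fderiv ℂ (f j) w) atTop (Metric.ball z (r / 2)) := by
    rw [Metric.uniformCauchySeqOn_iff] at hc ⊢
    intro ε hε
    obtain ⟨N, hN⟩ := hc (ε / 2 * (r / 2 / 2)) (by positivity)
    refine ⟨N, fun m hm n hn w hw => ?_⟩
    have hd : ∀ j, DifferentiableOn ℂ (f j) (Metric.ball w (r / 2)) := fun j =>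
      (hf j).mono (hsub w hw)
    have hda : ∀ j, DifferentiableAt ℂ (f j) w := fun j =>
      (hd j).differentiableAt (Metric.ball_mem_nhds w (half_pos hr))
    rw [dist_eq_norm, ← fderiv_sub (hda m) (hda n)]
    have := norm_fderiv_le_of_forall_ball (M := ε / 2 * (r / 2 / 2)) (half_pos hr)
      ((hd m).sub (hd n)) fun x hx => by
        have := hN m hm n hn x (hsub w hw hx)
        rw [dist_eq_norm] at this
        exact this.le
    refine this.trans_lt ?_
    rw [mul_div_cancel_right₀ _ (by positivity)]
    exact half_lt_self hε
  have hlim : ∀ w, ∃ L, w ∈ Metric.ball z (r / 2) →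
      Tendsto (fun j => fderiv ℂ (f j) w) atTop (𝓝 L) := fun w => by
    by_cases hw : w ∈ Metric.ball z (r / 2)
    · obtain ⟨L, hL⟩ := cauchySeq_tendsto_of_complete (hc'.cauchySeq hw)
      exact ⟨L, fun _ => hL⟩
    · exact ⟨0, fun h => absurd h hw⟩
  choose g' hg' using hlim
  have hz := Metric.mem_ball_self (x := z) (half_pos hr)
  have hss : Metric.ball z (r / 2) ⊆ Metric.ball z r := Metric.ball_subset_ball (by linarith)
  refine (hasFDerivAt_of_tendstoUniformlyOn Metric.isOpen_ball
    (hc'.tendstoUniformlyOn_of_tendsto hg') (fun j w hw => ?_)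
    (fun w hw => hg w (hss hw)) hz).differentiableAt
  exact ((hf j).differentiableAt (Metric.isOpen_ball.mem_nhds (hss hw))).hasFDerivAt

/-! ### The Bergman space as a closed subspace of the square integrable functions -/

variable {n : ℕ} {Ω : Set (Fin n → ℂ)}

/-- The subspace of `L²(Ω)` formed by the classes of holomorphic functions. -/
def holomorphicL2 {n : ℕ} (Ω : Set (Fin n → ℂ)) :
    Submodule ℂ (Lp ℂ 2 (volume.restrict Ω)) where
  carrier := {F | ∃ f, DifferentiableOn ℂ f Ω ∧ F =ᵐ[volume.restrict Ω] f}
  zero_mem' := ⟨0, differentiableOn_const 0, Lp.coeFn_zero _ _ _⟩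
  add_mem' := by
    rintro F G ⟨f, hf, hF⟩ ⟨g, hg, hG⟩
    exact ⟨f + g, hf.add hg, (Lp.coeFn_add F G).trans (hF.add hG)⟩
  smul_mem' := by
    rintro c F ⟨f, hf, hF⟩
    exact ⟨c • f, hf.const_smul c, (Lp.coeFn_smul c F).trans (hF.const_smul c)⟩

theorem memBergman_two_iff {f : (Fin n → ℂ) → ℂ} :
    MemBergman 2 Ω f ↔ DifferentiableOn ℂ f Ω ∧ IntegrableOn (fun ζ => ‖f ζ‖ ^ 2) Ω := by
  simp [MemBergman]

theorem MemBergman.memLp {n : ℕ} {Ω : Set (Fin n → ℂ)} {f : (Fin n → ℂ) → ℂ} (hΩ : IsOpen Ω)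
    (hf : MemBergman 2 Ω f) : MemLp f 2 (volume.restrict Ω) := by
  obtain ⟨hd, hi⟩ := memBergman_two_iff.1 hf
  exact (memLp_two_iff_integrable_sq_norm
    (hd.continuousOn.aestronglyMeasurable hΩ.measurableSet)).2 hi

theorem memBergman_two_of_ae_eq {f : (Fin n → ℂ) → ℂ} {F : Lp ℂ 2 (volume.restrict Ω)}
    (hf : DifferentiableOn ℂ f Ω) (hF : F =ᵐ[volume.restrict Ω] f) : MemBergman 2 Ω f :=
  memBergman_two_iff.2 ⟨hf, (memLp_two_iff_integrable_sq_norm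
    ((Lp.aestronglyMeasurable F).congr hF)).1 ((memLp_congr_ae hF).1 (Lp.memLp F))⟩

theorem setIntegral_norm_sq_eq {f : (Fin n → ℂ) → ℂ} {F : Lp ℂ 2 (volume.restrict Ω)}
    (hF : F =ᵐ[volume.restrict Ω] f) : ∫ ζ in Ω, ‖f ζ‖ ^ 2 = ‖F‖ ^ 2 := by
  have h1 : (inner ℂ F F : ℂ) = ((∫ ζ in Ω, ‖f ζ‖ ^ 2 : ℝ) : ℂ) := by
    rw [L2.inner_def, ← integral_complex_ofReal]
    refine integral_congr_ae ?_
    filter_upwards [hF] with ζ hζ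
    rw [hζ, inner_self_eq_norm_sq_to_K]
    simp
  refine Complex.ofReal_injective ?_
  rw [← h1, inner_self_eq_norm_sq_to_K]
  simp

/-- Point evaluation is bounded by the `L²` norm, locally uniformly in the point. -/
theorem exists_ball_norm_le (hΩ : IsOpen Ω) {z : Fin n → ℂ} (hz : z ∈ Ω) :
    ∃ r > 0, ∃ C, Metric.ball z r ⊆ Ω ∧ ∀ (F : Lp ℂ 2 (volume.restrict Ω)) (f : (Fin n → ℂ) → ℂ),
      DifferentiableOn ℂ f Ω → F =ᵐ[volume.restrict Ω] f →
        ∀ w ∈ Metric.ball z r, ‖f w‖ ≤ C * ‖F‖ := by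
  obtain ⟨r, hr, hrΩ⟩ := Metric.isOpen_iff.1 hΩ z hz
  refine ⟨r / 2, half_pos hr, √(volume.real (Metric.ball z (r / 2)))⁻¹,
    (Metric.ball_subset_ball (by linarith)).trans hrΩ, fun F f hf hF w hw => ?_⟩
  have hsub : Metric.ball w (r / 2) ⊆ Ω :=
    (Metric.ball_subset_ball' (by rw [Metric.mem_ball] at hw; linarith)).trans hrΩ
  have h := norm_sq_le_setIntegral (half_pos hr) hsub hf
    (memBergman_two_iff.1 (memBergman_two_of_ae_eq hf hF)).2
  have hv : volume.real (Metric.ball w (r / 2)) = volume.real (Metric.ball z (r / 2)) := by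
    simp only [Measure.real]
    rw [Measure.addHaar_ball_center, Measure.addHaar_ball_center _ z]
  rw [setIntegral_norm_sq_eq hF, hv] at h
  refine le_of_sq_le_sq ?_ (by positivity)
  rwa [mul_pow, Real.sq_sqrt (by positivity)]

theorem isClosed_holomorphicL2 (hΩ : IsOpen Ω) :
    IsClosed (holomorphicL2 Ω : Set (Lp ℂ 2 (volume.restrict Ω))) := by
  refine IsSeqClosed.isClosed fun Fs F hFs hlim => ?_
  choose f hf hFf using hFs
  have hcauchy : ∀ z ∈ Ω, ∃ r > 0, Metric.ball z r ⊆ Ω ∧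
      UniformCauchySeqOn f atTop (Metric.ball z r) := fun z hz => by
    obtain ⟨r, hr, C, hrΩ, hC⟩ := exists_ball_norm_le hΩ hz
    refine ⟨r, hr, hrΩ, Metric.uniformCauchySeqOn_iff.2 fun ε hε => ?_⟩
    obtain ⟨N, hN⟩ := Metric.cauchySeq_iff.1 hlim.cauchySeq (ε / (|C| + 1)) (by positivity)
    refine ⟨N, fun i hi j hj w hw => ?_⟩
    have h1 := hC (Fs i - Fs j) (f i - f j) ((hf i).sub (hf j))
      ((Lp.coeFn_sub _ _).trans ((hFf i).sub (hFf j))) w hw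
    have h2 := hN i hi j hj
    rw [dist_eq_norm] at h2 ⊢
    calc ‖f i w - f j w‖ ≤ C * ‖Fs i - Fs j‖ := h1
      _ ≤ (|C| + 1) * ‖Fs i - Fs j‖ := by gcongr; linarith [le_abs_self C]
      _ < (|C| + 1) * (ε / (|C| + 1)) := by gcongr
      _ = ε := by field_simp
  have hex : ∀ w, ∃ L, w ∈ Ω → Tendsto (fun j => f j w) atTop (𝓝 L) := fun w => by
    by_cases hw : w ∈ Ω
    · obtain ⟨r, hr, -, hc⟩ := hcauchy w hw
      obtain ⟨L, hL⟩ := cauchySeq_tendsto_of_complete (hc.cauchySeq (Metric.mem_ball_self hr))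
      exact ⟨L, fun _ => hL⟩
    · exact ⟨0, fun h => absurd h hw⟩
  choose g hg using hex
  refine ⟨g, fun z hz => ?_, ?_⟩
  · obtain ⟨r, hr, hrΩ, hc⟩ := hcauchy z hz
    exact (differentiableAt_of_uniformCauchySeqOn hr (fun j => (hf j).mono hrΩ) hc
      fun w hw => hg w (hrΩ hw)).differentiableWithinAt
  · obtain ⟨ns, hns, hae⟩ := (tendstoInMeasure_of_tendsto_Lp hlim).exists_seq_tendsto_ae
    filter_upwards [hae, ae_all_iff.2 hFf, ae_restrict_mem hΩ.measurableSet] with ζ h1 h2 h3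
    simp only [h2] at h1
    exact tendsto_nhds_unique h1 ((hg ζ h3).comp hns.tendsto_atTop)

/-! ### Reproducing kernels -/

/-- `k` is the reproducing kernel at `z` of the Bergman space `A²(Ω)`, that is, `k = K₂(·, z)` on
`Ω`. -/
def IsReproducingKernel {n : ℕ} (Ω : Set (Fin n → ℂ)) (z : Fin n → ℂ) (k : (Fin n → ℂ) → ℂ) :
    Prop :=
  MemBergman 2 Ω k ∧ ∀ f, MemBergman 2 Ω f → f z = ∫ ζ in Ω, f ζ * (starRingEnd ℂ) (k ζ)

theorem exists_isReproducingKernel (hΩ : IsOpen Ω) {z : Fin n → ℂ} (hz : z ∈ Ω) :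
    ∃ k, IsReproducingKernel Ω z k := by
  have : CompleteSpace (holomorphicL2 Ω) := (isClosed_holomorphicL2 hΩ).completeSpace_coe
  have huniq : ∀ {f g : (Fin n → ℂ) → ℂ} {F : Lp ℂ 2 (volume.restrict Ω)},
      DifferentiableOn ℂ f Ω → DifferentiableOn ℂ g Ω → F =ᵐ[volume.restrict Ω] f →
      F =ᵐ[volume.restrict Ω] g → f z = g z := fun hf hg h1 h2 =>
    Measure.eqOn_open_of_ae_eq (h1.symm.trans h2) hΩ hf.continuousOn hg.continuousOn hz
  -- Evaluation at `z` is well defined on classes: holomorphic representatives of one class agree.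
  choose rep hrep hrepF using fun F : holomorphicL2 Ω => F.2
  obtain ⟨r, hr, C, -, hC⟩ := exists_ball_norm_le hΩ hz
  let ev : holomorphicL2 Ω →ₗ[ℂ] ℂ :=
    { toFun := fun F => rep F z
      map_add' := fun F G => huniq (g := rep F + rep G) (hrep _) ((hrep F).add (hrep G)) (hrepF _)
        ((Lp.coeFn_add _ _).trans ((hrepF F).add (hrepF G)))
      map_smul' := fun c F => huniq (g := c • rep F) (hrep _) ((hrep F).const_smul c) (hrepF _)
        ((Lp.coeFn_smul _ _).trans ((hrepF F).const_smul c)) }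
  let evL : StrongDual ℂ (holomorphicL2 Ω) := ev.mkContinuous C fun F =>
    hC F (rep F) (hrep F) (hrepF F) z (Metric.mem_ball_self hr)
  set K := (InnerProductSpace.toDual ℂ (holomorphicL2 Ω)).symm evL with hK
  refine ⟨rep K, memBergman_two_of_ae_eq (hrep K) (hrepF K), fun f hf => ?_⟩
  have hfL := hf.memLp hΩ
  let F : holomorphicL2 Ω := ⟨hfL.toLp f, f, hf.1, hfL.coeFn_toLp⟩
  have h1 : rep F z = inner ℂ K F := by
    rw [hK, InnerProductSpace.toDual_symm_apply]; rfl
  rw [huniq hf.1 (hrep F) hfL.coeFn_toLp (hrepF F), h1, Submodule.coe_inner, L2.inner_def]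
  refine integral_congr_ae ?_
  filter_upwards [hrepF K, hfL.coeFn_toLp] with ζ h2 h3
  rw [h2, h3]
  rfl

theorem norm_setIntegral_mul_conj_sq_le (hΩ : IsOpen Ω) {f k : (Fin n → ℂ) → ℂ}
    (hf : MemBergman 2 Ω f) (hk : MemBergman 2 Ω k) :
    ‖∫ ζ in Ω, f ζ * (starRingEnd ℂ) (k ζ)‖ ^ 2 ≤
      (∫ ζ in Ω, ‖k ζ‖ ^ 2) * ∫ ζ in Ω, ‖f ζ‖ ^ 2 := by
  have hfL := hf.memLp hΩ
  have hkL := hk.memLp hΩ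
  have h : ∫ ζ in Ω, f ζ * (starRingEnd ℂ) (k ζ) = inner ℂ (hkL.toLp k) (hfL.toLp f) := by
    rw [L2.inner_def]
    refine integral_congr_ae ?_
    filter_upwards [hkL.coeFn_toLp, hfL.coeFn_toLp] with ζ h2 h3
    rw [h2, h3]
    rfl
  rw [h, setIntegral_norm_sq_eq hkL.coeFn_toLp, setIntegral_norm_sq_eq hfL.coeFn_toLp, ← mul_pow]
  gcongr
  exact norm_inner_le_norm _ _

/-! ### Bergman spaces of bounded and of balanced sets -/

theorem IsCompleteReinhardt.balanced (h : IsCompleteReinhardt Ω) : Balanced ℂ Ω := by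
  rw [balanced_iff_smul_mem]
  intro c hc z hz
  refine h z hz _ fun j => ?_
  rw [Pi.smul_apply, norm_smul]
  exact mul_le_of_le_one_left (norm_nonneg _) hc

theorem memBergman_two_iff_memLp (hΩ : IsOpen Ω) {f : (Fin n → ℂ) → ℂ} :
    MemBergman 2 Ω f ↔ DifferentiableOn ℂ f Ω ∧ MemLp f 2 (volume.restrict Ω) :=
  ⟨fun h => ⟨h.1, h.memLp hΩ⟩, fun h => memBergman_two_iff.2 ⟨h.1,
    (memLp_two_iff_integrable_sq_norm h.2.aestronglyMeasurable).1 h.2⟩⟩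

theorem memBergman_const {p : ℝ} (hbdd : Bornology.IsBounded Ω) (c : ℂ) :
    MemBergman p Ω fun _ => c :=
  ⟨differentiableOn_const c, integrableOn_const hbdd.measure_lt_top.ne⟩

theorem volume_real_pos (hΩ : IsOpen Ω) (hbdd : Bornology.IsBounded Ω) (hne : Ω.Nonempty) :
    0 < volume.real Ω :=
  ENNReal.toReal_pos (hΩ.measure_pos volume hne).ne' hbdd.measure_lt_top.ne

theorem MemBergman.comp_smul {f : (Fin n → ℂ) → ℂ} (hΩ : IsOpen Ω) (hbal : Balanced ℂ Ω)
    (hf : MemBergman 2 Ω f) {t : ℝ} (ht : 0 < t) (ht1 : t ≤ 1) :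
    MemBergman 2 Ω fun ζ => f ((t : ℂ) • ζ) := by
  have hmem : ∀ ζ ∈ Ω, (t : ℂ) • ζ ∈ Ω := fun ζ hζ =>
    hbal.smul_mem (by rwa [Complex.norm_real, Real.norm_of_nonneg ht.le]) hζ
  rw [memBergman_two_iff] at hf ⊢
  refine ⟨hf.1.comp (f := fun ζ : Fin n → ℂ => (t : ℂ) • ζ) (by fun_prop) hmem, ?_⟩
  have h1 := (integrable_indicator_iff hΩ.measurableSet).2 hf.2
  have h2 := (h1.comp_smul ht.ne').integrableOn (s := Ω)
  -- The integrable function is `|f| ^ 2`, extended by zero outside `Ω` before the dilation.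
  refine h2.congr_fun (fun ζ hζ => ?_) hΩ.measurableSet
  have : t • ζ = (t : ℂ) • ζ := (Complex.coe_smul t ζ).symm
  simp only [this]
  rw [indicator_of_mem (hmem ζ hζ)]

/-- The symmetry `K₂(ζ, t z) = K₂(t ζ, z)`, which holds because the dilation by `t` is self-adjoint
on `A²(Ω)`. -/
theorem IsReproducingKernel.comp_smul {z : Fin n → ℂ} {k : (Fin n → ℂ) → ℂ} (hΩ : IsOpen Ω)
    (hbal : Balanced ℂ Ω) (hk : IsReproducingKernel Ω z k) {t : ℝ} (ht : 0 < t) (ht1 : t ≤ 1) :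
    IsReproducingKernel Ω ((t : ℂ) • z) fun ζ => k ((t : ℂ) • ζ) := by
  have hk' := hk.1.comp_smul hΩ hbal ht ht1
  refine ⟨hk', fun f hf => ?_⟩
  have hf' := hf.comp_smul hΩ hbal ht ht1
  have hcirc : ∀ c : ℂ, ‖c‖ = 1 → ∀ ζ ∈ Ω, c • ζ ∈ Ω := fun c hc ζ hζ => hbal.smul_mem hc.le hζ
  have hcomm : ∀ (c : ℂ) (ζ : Fin n → ℂ), (t : ℂ) • c • ζ = ((t : ℂ) * c) • ζ := fun c ζ =>
    smul_smul _ _ _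
  have hint : ∀ {f g : (Fin n → ℂ) → ℂ}, MemBergman 2 Ω f → MemBergman 2 Ω g →
      ContinuousOn (fun ζ => f ζ * (starRingEnd ℂ) (g ζ)) Ω ∧
      IntegrableOn (fun ζ => f ζ * (starRingEnd ℂ) (g ζ)) Ω := fun hf hg =>
    ⟨hf.1.continuousOn.mul (Complex.continuous_conj.comp_continuousOn hg.1.continuousOn),
      (hf.memLp hΩ).integrable_mul (hg.memLp hΩ).star⟩
  rw [hk.2 _ hf', setIntegral_eq_circleAverage hΩ hcirc (hint hf' hk.1).1 (hint hf' hk.1).2,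
    setIntegral_eq_circleAverage hΩ hcirc (hint hf hk').1 (hint hf hk').2]
  refine setIntegral_congr_fun hΩ.measurableSet fun ζ hζ => ?_
  simp only [hcomm]
  exact circleAverage_dilate ht ht1 (diffContOnCl_comp_smul hΩ hbal hf.1 hζ)
    (diffContOnCl_comp_smul hΩ hbal hk.1.1 hζ)

theorem IsReproducingKernel.apply_zero_ne_zero {z : Fin n → ℂ} {k : (Fin n → ℂ) → ℂ}
    (hΩ : IsOpen Ω) (hbdd : Bornology.IsBounded Ω) (hbal : Balanced ℂ Ω)
    (hk : IsReproducingKernel Ω z k) : k 0 ≠ 0 := by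
  have : IsFiniteMeasure (volume.restrict Ω) := isFiniteMeasure_restrict.2 hbdd.measure_lt_top.ne
  have h1 := hk.2 _ (memBergman_const hbdd 1)
  simp only [one_mul] at h1
  rw [integral_conj, hbal.setIntegral_eq hΩ hk.1.1 ((hk.1.memLp hΩ).integrable one_le_two)] at h1
  intro h0
  simp [h0] at h1

theorem IsReproducingKernel.apply_self {z : Fin n → ℂ} {k : (Fin n → ℂ) → ℂ}
    (hk : IsReproducingKernel Ω z k) : k z = ((∫ ζ in Ω, ‖k ζ‖ ^ 2 : ℝ) : ℂ) := by
  rw [hk.2 k hk.1, ← integral_complex_ofReal]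
  simp [Complex.mul_conj']

theorem IsReproducingKernel.norm_sq_le {z : Fin n → ℂ} {f k : (Fin n → ℂ) → ℂ} (hΩ : IsOpen Ω)
    (hk : IsReproducingKernel Ω z k) (hf : MemBergman 2 Ω f) :
    ‖f z‖ ^ 2 ≤ (∫ ζ in Ω, ‖k ζ‖ ^ 2) * ∫ ζ in Ω, ‖f ζ‖ ^ 2 := by
  rw [hk.2 f hf]
  exact norm_setIntegral_mul_conj_sq_le hΩ hf hk.1

theorem IsReproducingKernel.integral_pos {z : Fin n → ℂ} {k : (Fin n → ℂ) → ℂ} (hΩ : IsOpen Ω)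
    (hbdd : Bornology.IsBounded Ω) (hk : IsReproducingKernel Ω z k) :
    0 < ∫ ζ in Ω, ‖k ζ‖ ^ 2 := by
  have h := hk.norm_sq_le hΩ (memBergman_const hbdd 1)
  refine lt_of_le_of_ne (integral_nonneg fun ζ => by positivity) fun h0 => ?_
  rw [← h0] at h
  norm_num at h

/-- Uniqueness of the minimizer for `p = 2`: a competitor whose norm does not exceed that of
`k / k z` equals it on `Ω`, by the parallelogram law. -/
theorem IsReproducingKernel.eqOn_of_integral_le {z : Fin n → ℂ} {f k : (Fin n → ℂ) → ℂ}
    (hΩ : IsOpen Ω) (hbdd : Bornology.IsBounded Ω) (hk : IsReproducingKernel Ω z k)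
    (hf : MemBergman 2 Ω f) (hfz : f z = 1)
    (hle : ∫ ζ in Ω, ‖f ζ‖ ^ 2 ≤ ∫ ζ in Ω, ‖k ζ / k z‖ ^ 2) :
    EqOn f (fun ζ => k ζ / k z) Ω := by
  set N := ∫ ζ in Ω, ‖k ζ‖ ^ 2 with hN
  have hNpos : 0 < N := hk.integral_pos hΩ hbdd
  have hkz : k z = (N : ℂ) := hk.apply_self
  have hκN : ∫ ζ in Ω, ‖k ζ / k z‖ ^ 2 = N⁻¹ := by
    simp only [norm_div, div_pow, hkz, Complex.norm_real, Real.norm_of_nonneg hNpos.le]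
    rw [integral_div, ← hN]
    field_simp
  have hfL := hf.memLp hΩ
  have hκL : MemLp (fun ζ => k ζ / k z) 2 (volume.restrict Ω) := by
    simpa only [div_eq_inv_mul] using (hk.1.memLp hΩ).const_mul (k z)⁻¹
  have hκd : DifferentiableOn ℂ (fun ζ => k ζ / k z) Ω := by
    simpa only [div_eq_mul_inv] using hk.1.1.mul_const (k z)⁻¹
  have hadd : MemBergman 2 Ω (fun ζ => f ζ + k ζ / k z) :=
    (memBergman_two_iff_memLp hΩ).2 ⟨hf.1.add hκd, hfL.add hκL⟩
  have hsub : MemBergman 2 Ω (fun ζ => f ζ - k ζ / k z) :=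
    (memBergman_two_iff_memLp hΩ).2 ⟨hf.1.sub hκd, hfL.sub hκL⟩
  have hκ : MemBergman 2 Ω (fun ζ => k ζ / k z) := (memBergman_two_iff_memLp hΩ).2 ⟨hκd, hκL⟩
  rw [memBergman_two_iff] at hf hκ
  have hpar : (∫ ζ in Ω, ‖f ζ + k ζ / k z‖ ^ 2) + ∫ ζ in Ω, ‖f ζ - k ζ / k z‖ ^ 2 =
      2 * (∫ ζ in Ω, ‖f ζ‖ ^ 2) + 2 * ∫ ζ in Ω, ‖k ζ / k z‖ ^ 2 := by
    rw [← integral_add (memBergman_two_iff.1 hadd).2 (memBergman_two_iff.1 hsub).2,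
      ← integral_const_mul, ← integral_const_mul,
      ← integral_add (hf.2.const_mul 2) (hκ.2.const_mul 2)]
    congr 1 with ζ
    have := parallelogram_law_with_norm ℂ (f ζ) (k ζ / k z)
    linarith
  have h4 := hk.norm_sq_le hΩ hadd
  have h2 : f z + k z / k z = 2 := by
    rw [hfz, div_self (by rw [hkz]; exact_mod_cast hNpos.ne')]; norm_num
  rw [h2, ← hN] at h4
  norm_num at h4
  -- The sum takes the value `2` at `z`, so its squared norm is at least `4 / N`.
  have h5 : 4 * N⁻¹ ≤ ∫ ζ in Ω, ‖f ζ + k ζ / k z‖ ^ 2 := by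
    rw [← div_eq_mul_inv, div_le_iff₀ hNpos]; linarith
  have h6 : ∫ ζ in Ω, ‖f ζ - k ζ / k z‖ ^ 2 ≤ 0 := by rw [hκN] at hle hpar; linarith
  intro w hw
  obtain ⟨r, hr, hrΩ⟩ := Metric.isOpen_iff.1 hΩ w hw
  have h7 := norm_sq_le_setIntegral hr hrΩ hsub.1 (memBergman_two_iff.1 hsub).2
  have h8 : ‖f w - k w / k z‖ ^ 2 ≤ 0 :=
    h7.trans (mul_nonpos_of_nonneg_of_nonpos (by positivity) h6)
  have h9 : ‖f w - k w / k z‖ = 0 := by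
    have := sq_nonneg ‖f w - k w / k z‖
    exact pow_eq_zero_iff two_ne_zero |>.1 (le_antisymm h8 this)
  exact sub_eq_zero.1 (norm_eq_zero.1 h9)

/-! ### Minimizers and diagonal kernels for even exponents -/

theorem norm_rpow_two_mul (c : ℂ) (m : ℕ) : ‖c‖ ^ (2 * (m : ℝ)) = ‖c ^ m‖ ^ 2 := by
  rw [norm_pow, ← pow_mul, mul_comm m 2, ← Real.rpow_natCast]
  push_cast
  rfl

theorem memBergman_two_mul_iff {f : (Fin n → ℂ) → ℂ} {m : ℕ} : MemBergman (2 * (m : ℝ)) Ω f ↔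
    DifferentiableOn ℂ f Ω ∧ IntegrableOn (fun ζ => ‖f ζ ^ m‖ ^ 2) Ω := by
  simp only [MemBergman, norm_rpow_two_mul]

theorem MemBergman.pow {f : (Fin n → ℂ) → ℂ} {m : ℕ} (hf : MemBergman (2 * (m : ℝ)) Ω f) :
    MemBergman 2 Ω fun ζ => f ζ ^ m := by
  rw [memBergman_two_mul_iff] at hf
  exact memBergman_two_iff.2 ⟨hf.1.pow m, hf.2⟩

theorem bergmanNorm_two_mul (f : (Fin n → ℂ) → ℂ) (m : ℕ) :
    bergmanNorm (2 * (m : ℝ)) Ω f = (∫ ζ in Ω, ‖f ζ ^ m‖ ^ 2) ^ (1 / (2 * (m : ℝ))) := by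
  simp only [bergmanNorm, norm_rpow_two_mul]

theorem bergmanNorm_two_mul_le_iff {f g : (Fin n → ℂ) → ℂ} {m : ℕ} (hm : 0 < m) :
    bergmanNorm (2 * (m : ℝ)) Ω f ≤ bergmanNorm (2 * (m : ℝ)) Ω g ↔
      ∫ ζ in Ω, ‖f ζ ^ m‖ ^ 2 ≤ ∫ ζ in Ω, ‖g ζ ^ m‖ ^ 2 := by
  rw [bergmanNorm_two_mul, bergmanNorm_two_mul]
  exact Real.rpow_le_rpow_iff (integral_nonneg fun ζ => by positivity)
    (integral_nonneg fun ζ => by positivity) (by positivity)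

/-- If the reproducing kernel at `z` has a holomorphic `m`-th root on `Ω`, the `m`-th power of the
minimizer for `p = 2 m` is the minimizer for `p = 2`. This includes the existence of the minimizer,
so that `bergmanMin` does not take its default value here. -/
theorem IsReproducingKernel.bergmanMin_pow {z : Fin n → ℂ} {g k : (Fin n → ℂ) → ℂ} (hΩ : IsOpen Ω)
    (hbdd : Bornology.IsBounded Ω) (hz : z ∈ Ω) (hk : IsReproducingKernel Ω z k) {m : ℕ}
    (hm : 0 < m) (hg : DifferentiableOn ℂ g Ω) (hgk : ∀ ζ ∈ Ω, g ζ ^ m = k ζ) {ζ : Fin n → ℂ}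
    (hζ : ζ ∈ Ω) : bergmanMin (2 * (m : ℝ)) Ω ζ z ^ m = k ζ / k z := by
  have hNpos := hk.integral_pos hΩ hbdd
  have hkz : k z ≠ 0 := by rw [hk.apply_self]; exact_mod_cast hNpos.ne'
  have hgz : g z ≠ 0 := fun h => hkz (by rw [← hgk z hz, h, zero_pow hm.ne'])
  set κ : (Fin n → ℂ) → ℂ := fun ζ => g ζ / g z with hκ
  have hκm : ∀ ζ ∈ Ω, κ ζ ^ m = k ζ / k z := fun ζ hζ => by
    simp only [hκ, div_pow, hgk ζ hζ, hgk z hz]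
  have hκN : ∫ ζ in Ω, ‖κ ζ ^ m‖ ^ 2 = ∫ ζ in Ω, ‖k ζ / k z‖ ^ 2 :=
    setIntegral_congr_fun hΩ.measurableSet fun ζ hζ => by simp only [hκm ζ hζ]
  have hκmem : MemBergman (2 * (m : ℝ)) Ω κ := by
    refine memBergman_two_mul_iff.2 ⟨by
      simpa only [hκ, div_eq_mul_inv] using hg.mul_const (g z)⁻¹, ?_⟩
    have : IntegrableOn (fun ζ => ‖k ζ / k z‖ ^ 2) Ω := by
      simp only [norm_div, div_pow]
      exact (memBergman_two_iff.1 hk.1).2.div_const _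
    exact this.congr_fun (fun ζ hζ => by simp only [hκm ζ hζ]) hΩ.measurableSet
  have hκN' : ∫ ζ in Ω, ‖k ζ / k z‖ ^ 2 = (∫ ζ in Ω, ‖k ζ‖ ^ 2)⁻¹ := by
    simp only [norm_div, div_pow]
    rw [integral_div, hk.apply_self, Complex.norm_real, Real.norm_of_nonneg hNpos.le]
    field_simp
  have hmin : IsBergmanMinimizer (2 * (m : ℝ)) Ω z κ := by
    refine ⟨hκmem, div_self hgz, fun f hf hfz => ?_⟩
    rw [bergmanNorm_two_mul_le_iff hm, hκN, hκN', inv_le_iff_one_le_mul₀' hNpos]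
    simpa [hfz] using hk.norm_sq_le hΩ hf.pow
  have hex : ∃ f, IsBergmanMinimizer (2 * (m : ℝ)) Ω z f := ⟨κ, hmin⟩
  obtain ⟨h1, h2, h3⟩ := hex.choose_spec
  have h4 := (bergmanNorm_two_mul_le_iff hm).1 (h3 κ hκmem (div_self hgz))
  rw [hκN] at h4
  rw [bergmanMin, dif_pos hex]
  exact hk.eqOn_of_integral_le hΩ hbdd h1.pow (by simp only [h2, one_pow]) h4 hζ

/-- Lower bound for the diagonal kernel from constant functions. The set whose supremum is taken is
bounded above, since `f ^ m` lies in `A²` for `f ∈ A^{2m}`. -/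
theorem inv_volume_le_bergmanDiag {z : Fin n → ℂ} (hΩ : IsOpen Ω) (hbdd : Bornology.IsBounded Ω)
    (hz : z ∈ Ω) {m : ℕ} (hm : 0 < m) :
    (volume.real Ω)⁻¹ ≤ bergmanDiag (2 * (m : ℝ)) Ω z := by
  obtain ⟨k, hk⟩ := exists_isReproducingKernel hΩ hz
  have hv := volume_real_pos hΩ hbdd ⟨z, hz⟩
  have hp : 0 < 2 * (m : ℝ) := by positivity
  refine le_csSup ⟨∫ ζ in Ω, ‖k ζ‖ ^ 2, ?_⟩ ?_
  · rintro _ ⟨f, hf, hf1, rfl⟩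
    have hI : ∫ ζ in Ω, ‖f ζ ^ m‖ ^ 2 = 1 := by
      rw [bergmanNorm_two_mul] at hf1
      rw [← Real.rpow_inv_rpow (x := ∫ ζ in Ω, ‖f ζ ^ m‖ ^ 2)
        (integral_nonneg fun ζ => by positivity) hp.ne', ← one_div, hf1, Real.one_rpow]
    have := hk.norm_sq_le hΩ hf.pow
    rwa [hI, mul_one, ← norm_rpow_two_mul] at this
  · set c : ℝ := (volume.real Ω)⁻¹ ^ (2 * (m : ℝ))⁻¹ with hc
    have hc0 : 0 ≤ c := by positivity
    have hcp : ‖(c : ℂ)‖ ^ (2 * (m : ℝ)) = (volume.real Ω)⁻¹ := by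
      rw [Complex.norm_real, Real.norm_of_nonneg hc0, hc, Real.rpow_inv_rpow (by positivity) hp.ne']
    refine ⟨fun _ => (c : ℂ), memBergman_const hbdd _, ?_, hcp.symm⟩
    rw [bergmanNorm, hcp]
    simp [hv.ne']

/-! ### Holomorphic roots of zero-free functions -/

/-- A continuous branch of the `m`-th root of a zero-free holomorphic function is holomorphic. -/
theorem differentiableOn_of_pow {V : Type*} [NormedAddCommGroup V] [NormedSpace ℂ V] {U : Set V}
    {g h : V → ℂ} {m : ℕ} (hU : IsOpen U) (hg : ContinuousOn g U) (hh : DifferentiableOn ℂ h U)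
    (hgh : ∀ x ∈ U, g x ^ m = h x) (hne : ∀ x ∈ U, h x ≠ 0) (hm : m ≠ 0) :
    DifferentiableOn ℂ g U := by
  intro x hx
  have hgx : g x ≠ 0 := fun h0 => hne x hx (by rw [← hgh x hx, h0, zero_pow hm])
  have hs : HasStrictDerivAt (fun w : ℂ => w ^ m) (m * g x ^ (m - 1)) (g x) :=
    hasStrictDerivAt_pow m (g x)
  have hd : (m : ℂ) * g x ^ (m - 1) ≠ 0 := by
    simp [hm, hgx]
  have h1 := (hs.to_localInverse hd).hasDerivAt.differentiableAt
  have h2 := ((hg.continuousAt (hU.mem_nhds hx)).eventually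
    (HasStrictFDerivAt.eventually_left_inverse (hs.hasStrictFDerivAt_equiv hd)))
  have h3 : g =ᶠ[𝓝 x] fun y => HasStrictDerivAt.localInverse _ _ _ hs hd (h y) := by
    filter_upwards [h2, hU.mem_nhds hx] with y hy hyU
    rw [← hgh y hyU]
    exact hy.symm
  rw [hgh x hx] at h1
  exact ((h1.comp x (hh.differentiableAt (hU.mem_nhds hx))).congr_of_eventuallyEq
    h3).differentiableWithinAt

theorem exists_differentiableOn_pow_eq (hΩ : IsOpen Ω) (hbal : Balanced ℂ Ω) (hne : Ω.Nonempty)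
    {h : (Fin n → ℂ) → ℂ} (hh : DifferentiableOn ℂ h Ω) (h0 : ∀ ζ ∈ Ω, h ζ ≠ 0) {m : ℕ}
    (hm : 0 < m) : ∃ g, DifferentiableOn ℂ g Ω ∧ ∀ ζ ∈ Ω, g ζ ^ m = h ζ := by
  have hstar : StarConvex ℝ 0 Ω := by
    rw [starConvex_zero_iff]
    intro x hx a ha ha1
    rw [← Complex.coe_smul]
    exact hbal.smul_mem (by rwa [Complex.norm_real, Real.norm_of_nonneg ha]) hx
  have : ContractibleSpace Ω := hstar.contractibleSpace hne
  have hsc : IsSimplyConnected Ω := show SimplyConnectedSpace Ω from inferInstance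
  obtain ⟨g, hg, hgh⟩ := Complex.exists_continuousOn_pow_eq hsc hΩ hh.continuousOn
    (by rintro ⟨x, hx, hx0⟩; exact h0 x hx hx0) hm.ne'
  exact ⟨g, differentiableOn_of_pow hΩ hg hh (fun x _ => hgh x) h0 hm.ne', fun ζ _ => hgh ζ⟩

/-! ### The first zero on the boundary -/

/-- Dilating by a factor less than one moves the closure of a complete Reinhardt set into the set.
Being balanced would not suffice for this. -/
theorem IsCompleteReinhardt.smul_mem_of_mem_closure (h : IsCompleteReinhardt Ω) {c : ℂ}
    (hc : ‖c‖ < 1) {ζ : Fin n → ℂ} (hζ : ζ ∈ closure Ω) : c • ζ ∈ Ω := by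
  have hev : ∀ᶠ w in 𝓝 ζ, ∀ j, ‖(c • ζ) j‖ ≤ ‖w j‖ := by
    refine eventually_all.2 fun j => ?_
    simp only [Pi.smul_apply, norm_smul]
    rcases eq_or_ne (ζ j) 0 with h0 | h0
    · simp [h0]
    · have hlt : ‖c‖ * ‖ζ j‖ < ‖ζ j‖ := mul_lt_of_lt_one_left (norm_pos_iff.2 h0) hc
      have hcont : Continuous fun w : Fin n → ℂ => ‖w j‖ := by fun_prop
      filter_upwards [hcont.continuousAt.eventually (lt_mem_nhds hlt)] with w hw using hw.le
  obtain ⟨w, hwΩ, hw⟩ := ((mem_closure_iff_frequently.1 hζ).and_eventually hev).exists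
  exact h w hwΩ _ hw

theorem IsOpen.exists_inv_smul_mem (hΩ : IsOpen Ω) {ζ : Fin n → ℂ} (hζ : ζ ∈ Ω) :
    ∃ s : ℝ, 0 < s ∧ s < 1 ∧ ((s : ℂ)⁻¹) • ζ ∈ Ω := by
  have hcont : ContinuousAt (fun s : ℝ => ((s : ℂ)⁻¹) • ζ) 1 := by
    exact (Complex.continuous_ofReal.continuousAt.inv₀ (by simp)).smul continuousAt_const
  have h1 : ∀ᶠ s : ℝ in 𝓝[<] 1, ((s : ℂ)⁻¹) • ζ ∈ Ω :=
    (hcont.eventually (hΩ.mem_nhds (by simpa using hζ))).filter_mono nhdsWithin_le_nhds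
  obtain ⟨s, hs, hs'⟩ := (h1.and (Ioo_mem_nhdsLT (zero_lt_one' ℝ))).exists
  exact ⟨s, hs'.1, hs'.2, hs⟩

/-- If `k` vanishes somewhere on `Ω` but not at the origin, then there is a smallest dilate `t • Ω`
whose closure contains a zero of `k`, and this zero lies on its boundary. -/
theorem exists_first_zero (hΩ : IsOpen Ω) (hbdd : Bornology.IsBounded Ω)
    (hR : IsCompleteReinhardt Ω) {k : (Fin n → ℂ) → ℂ} (hk : ContinuousOn k Ω) (hk0 : k 0 ≠ 0)
    (hzero : ∃ ζ ∈ Ω, k ζ = 0) :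
    ∃ t : ℝ, 0 < t ∧ t < 1 ∧ ∃ ζ₀ ∈ frontier Ω, k ((t : ℂ) • ζ₀) = 0 ∧
      ∀ s : ℝ, 0 ≤ s → s ≤ t → ∀ ζ ∈ Ω, k ((s : ℂ) • ζ) ≠ 0 := by
  obtain ⟨ζ₁, hζ₁, hkζ₁⟩ := hzero
  obtain ⟨s₁, hs₁, hs₁', hmem⟩ := hΩ.exists_inv_smul_mem hζ₁
  have hcpt : IsCompact (Icc 0 s₁ ×ˢ closure Ω) := isCompact_Icc.prod hbdd.isCompact_closure
  have hcont : ContinuousOn (fun p : ℝ × (Fin n → ℂ) => k ((p.1 : ℂ) • p.2))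
      (Icc 0 s₁ ×ˢ closure Ω) := by
    refine hk.comp (f := fun p : ℝ × (Fin n → ℂ) => (p.1 : ℂ) • p.2) (by fun_prop) ?_
    rintro ⟨s, ζ⟩ ⟨hs, hζ⟩
    refine hR.smul_mem_of_mem_closure ?_ hζ
    rw [Complex.norm_real, Real.norm_of_nonneg hs.1]
    exact hs.2.trans_lt hs₁'
  have hS := hcpt.of_isClosed_subset
    (hcont.preimage_isClosed_of_isClosed hcpt.isClosed (isClosed_singleton (x := (0 : ℂ))))
    inter_subset_left
  have hs₁c : (s₁ : ℂ) ≠ 0 := by exact_mod_cast hs₁.ne'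
  obtain ⟨⟨t, ζ₀⟩, ⟨⟨ht, hζ₀⟩, hk₀⟩, hmin⟩ := hS.exists_isMinOn
    ⟨(s₁, ((s₁ : ℂ)⁻¹) • ζ₁), ⟨⟨⟨hs₁.le, le_rfl⟩, subset_closure hmem⟩, by
      change k ((s₁ : ℂ) • ((s₁ : ℂ)⁻¹) • ζ₁) = 0
      rwa [smul_inv_smul₀ hs₁c]⟩⟩ (f := Prod.fst) continuous_fst.continuousOn
  simp only [mem_preimage, mem_singleton_iff] at hk₀
  -- A zero of `k` at `s ζ` with `ζ` interior can be written `(s σ) (σ⁻¹ ζ)` with `σ < 1` and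
  -- `σ⁻¹ ζ ∈ Ω`, which contradicts the minimality of `t` as soon as `s ≤ t`.
  have hne : ∀ s : ℝ, 0 ≤ s → s ≤ t → ∀ ζ ∈ Ω, k ((s : ℂ) • ζ) ≠ 0 := by
    intro s hs hst ζ hζ h0
    have hs0 : 0 < s := hs.lt_of_ne (by rintro rfl; simp [hk0] at h0)
    obtain ⟨σ, hσ, hσ', hσΩ⟩ := hΩ.exists_inv_smul_mem hζ
    have hσc : (σ : ℂ) ≠ 0 := by exact_mod_cast hσ.ne'
    have hlt : s * σ < s := mul_lt_of_lt_one_right hs0 hσ'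
    have : t ≤ s * σ := hmin (a := (s * σ, ((σ : ℂ)⁻¹) • ζ))
      ⟨⟨⟨by positivity, hlt.le.trans (hst.trans ht.2)⟩, subset_closure hσΩ⟩, by
        change k (((s * σ : ℝ) : ℂ) • ((σ : ℂ)⁻¹) • ζ) = 0
        rwa [Complex.ofReal_mul, mul_smul, smul_inv_smul₀ hσc]⟩
    linarith
  refine ⟨t, ht.1.lt_of_ne ?_, ht.2.trans_lt hs₁', ζ₀, ?_, hk₀, hne⟩
  · rintro rfl
    simp [hk0] at hk₀
  · rw [hΩ.frontier_eq]
    exact ⟨hζ₀, fun h => hne t ht.1 le_rfl ζ₀ h hk₀⟩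

/-! ### Zeros of finite order against Hölder bounds -/

/-- A zero of `H` at `t` has finite order `N`, because `H` does not vanish identically on the
disc. -/
theorem exists_order_bound {H : ℂ → ℂ} (hH : DifferentiableOn ℂ H (Metric.ball 0 1))
    (hH0 : H 0 ≠ 0) {t : ℝ} (ht : 0 < t) (ht1 : t < 1) :
    ∃ N : ℕ, ∃ c > 0, ∀ᶠ s : ℝ in 𝓝 t, c * |s - t| ^ N ≤ ‖H s‖ := by
  have han : AnalyticOnNhd ℂ H (Metric.ball 0 1) := hH.analyticOnNhd Metric.isOpen_ball
  have htm : (t : ℂ) ∈ Metric.ball (0 : ℂ) 1 := by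
    simpa [abs_of_pos ht] using ht1
  have hnz : ¬ ∀ᶠ w in 𝓝 (t : ℂ), H w = 0 := fun h => hH0
    (han.eqOn_zero_of_preconnected_of_eventuallyEq_zero
      (convex_ball 0 1).isPreconnected htm h (Metric.mem_ball_self one_pos))
  obtain ⟨N, g, hg, hg0, hev⟩ :=
    ((han t htm).exists_eventuallyEq_pow_smul_nonzero_iff).2 hnz
  refine ⟨N, ‖g t‖ / 2, by positivity, ?_⟩
  have hgn : ∀ᶠ w in 𝓝 (t : ℂ), ‖g t‖ / 2 < ‖g w‖ :=
    hg.continuousAt.norm.eventually (lt_mem_nhds (half_lt_self (norm_pos_iff.2 hg0)))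
  have hof : Tendsto (fun s : ℝ => (s : ℂ)) (𝓝 t) (𝓝 (t : ℂ)) :=
    Complex.continuous_ofReal.tendsto t
  filter_upwards [hof.eventually hev, hof.eventually hgn] with s h1 h2
  rw [h1, norm_smul, norm_pow, ← Complex.ofReal_sub, Complex.norm_real, Real.norm_eq_abs, mul_comm]
  gcongr

/-- The `m`-th root of a holomorphic function with a zero of finite order cannot be `O((t - s) ^ α)`
at the zero once `m` is large. -/
theorem exists_not_eventually_le {H : ℂ → ℂ} (hH : DifferentiableOn ℂ H (Metric.ball 0 1))
    (hH0 : H 0 ≠ 0) {t : ℝ} (ht : 0 < t) (ht1 : t < 1) {α : ℝ} (hα : 0 < α) :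
    ∃ m : ℕ, 0 < m ∧ ∀ (u : ℝ → ℂ) (a B : ℝ), 0 < a → ¬ ∀ᶠ s : ℝ in 𝓝[<] t,
      a * ‖H s‖ ≤ ‖u s‖ ^ m ∧ ‖u s‖ ≤ B * (t - s) ^ α := by
  obtain ⟨N, c, hc, hN⟩ := exists_order_bound hH hH0 ht ht1
  obtain ⟨m, hm⟩ := exists_nat_gt (N / α)
  have hm0 : 0 < m := by
    have : (0 : ℝ) < m := lt_of_le_of_lt (by positivity) hm
    exact_mod_cast this
  have hβ : 0 < α * m - N := by
    rw [div_lt_iff₀ hα] at hm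
    linarith
  refine ⟨m, hm0, fun u a B ha hev => ?_⟩
  have hlim : Tendsto (fun s : ℝ => B ^ m * (t - s) ^ (α * m - N)) (𝓝[<] t) (𝓝 0) := by
    have h1 : Tendsto (fun s : ℝ => t - s) (𝓝 t) (𝓝 (t - t)) := (continuous_const.sub
      continuous_id).tendsto t
    have h2 := (h1.rpow_const (p := α * m - N) (Or.inr hβ.le)).const_mul (B ^ m)
    rw [sub_self, Real.zero_rpow hβ.ne', mul_zero] at h2
    exact h2.mono_left nhdsWithin_le_nhds
  have hac : 0 < a * c := by positivity
  obtain ⟨s, ⟨h1, h2⟩, h3, h4, h5⟩ := (hev.and ((hN.filter_mono nhdsWithin_le_nhds).and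
    ((hlim.eventually (gt_mem_nhds hac)).and self_mem_nhdsWithin))).exists
  have hd : 0 < t - s := sub_pos.2 h5
  have habs : |s - t| = t - s := by rw [abs_sub_comm, abs_of_pos hd]
  have h6 : a * c * (t - s) ^ N ≤ B ^ m * (t - s) ^ (α * m - N) * (t - s) ^ N := by
    calc a * c * (t - s) ^ N = a * (c * |s - t| ^ N) := by rw [habs]; ring
      _ ≤ a * ‖H s‖ := by gcongr
      _ ≤ ‖u s‖ ^ m := h1
      _ ≤ (B * (t - s) ^ α) ^ m := by gcongr
      _ = B ^ m * (t - s) ^ (α * m - N) * (t - s) ^ N := by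
        rw [mul_pow, ← Real.rpow_natCast ((t - s) ^ α), ← Real.rpow_mul hd.le, mul_assoc,
          ← Real.rpow_natCast _ N, ← Real.rpow_add hd, sub_add_cancel]
  have h7 := le_of_mul_le_mul_right h6 (pow_pos hd N)
  linarith

/-! ### The off-diagonal kernel up to the boundary -/

/-- For zero-free `K₂(·, s z₁) = k(s ·)`, the modulus of a continuous extension of `K_{2m}(·, s z₁)`
is known up to the boundary. -/
theorem norm_pow_eq_of_isContExtension (hΩ : IsOpen Ω) (hbdd : Bornology.IsBounded Ω)
    (hR : IsCompleteReinhardt Ω) {z₁ : Fin n → ℂ} (hz₁ : z₁ ∈ Ω) {k : (Fin n → ℂ) → ℂ}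
    (hk : IsReproducingKernel Ω z₁ k) {s : ℝ} (hs : 0 < s) (hs1 : s < 1)
    (hne : ∀ ζ ∈ Ω, k ((s : ℂ) • ζ) ≠ 0) {m : ℕ} (hm : 0 < m) {v : (Fin n → ℂ) → ℂ}
    (hv : IsContExtension Ω (fun ζ => bergmanKernel (2 * (m : ℝ)) Ω ζ ((s : ℂ) • z₁)) v) :
    ∀ ζ ∈ closure Ω, ‖v ζ‖ ^ m = bergmanDiag (2 * (m : ℝ)) Ω ((s : ℂ) • z₁) ^ m /
      ‖k ((s : ℂ) • (s : ℂ) • z₁)‖ * ‖k ((s : ℂ) • ζ)‖ := by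
  have hbal := hR.balanced
  have hsn : ‖(s : ℂ)‖ < 1 := by rwa [Complex.norm_real, Real.norm_of_nonneg hs.le]
  have hz : (s : ℂ) • z₁ ∈ Ω := hbal.smul_mem hsn.le hz₁
  have hks := hk.comp_smul hΩ hbal hs hs1.le
  obtain ⟨g, hg, hgk⟩ := exists_differentiableOn_pow_eq hΩ hbal ⟨z₁, hz₁⟩ hks.1.1 hne hm
  have hD : 0 ≤ bergmanDiag (2 * (m : ℝ)) Ω ((s : ℂ) • z₁) :=
    (inv_nonneg.2 measureReal_nonneg).trans (inv_volume_le_bergmanDiag hΩ hbdd hz hm)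
  have hkc : ContinuousOn (fun ζ => k ((s : ℂ) • ζ)) (closure Ω) :=
    hk.1.1.continuousOn.comp (f := fun ζ : Fin n → ℂ => (s : ℂ) • ζ) (by fun_prop) fun ζ hζ =>
      hR.smul_mem_of_mem_closure hsn hζ
  refine Set.EqOn.of_subset_closure (s := Ω) (fun ζ hζ => ?_) (hv.1.norm.pow m)
    (continuousOn_const.mul hkc.norm) subset_closure subset_rfl
  rw [hv.2 hζ]
  change ‖bergmanKernel (2 * (m : ℝ)) Ω ζ ((s : ℂ) • z₁)‖ ^ m = _
  rw [bergmanKernel, norm_mul, mul_pow, ← norm_pow, hks.bergmanMin_pow hΩ hbdd hz hm hg hgk hζ, norm_div,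
    Complex.norm_real, Real.norm_of_nonneg hD]
  ring

theorem IsReproducingKernel.apply_eq_zero_of_bergmanKernel {z ζ : Fin n → ℂ}
    {k : (Fin n → ℂ) → ℂ} (hΩ : IsOpen Ω) (hbdd : Bornology.IsBounded Ω) (hz : z ∈ Ω)
    (hk : IsReproducingKernel Ω z k) (hζ : ζ ∈ Ω) (h : bergmanKernel 2 Ω ζ z = 0) : k ζ = 0 := by
  have h1 := hk.bergmanMin_pow hΩ hbdd hz one_pos hk.1.1 (fun _ _ => pow_one _) hζ
  have h2 := inv_volume_le_bergmanDiag hΩ hbdd hz one_pos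
  have h3 := inv_pos.2 (volume_real_pos hΩ hbdd ⟨z, hz⟩)
  have hkz : k z ≠ 0 := by
    rw [hk.apply_self]
    exact_mod_cast (hk.integral_pos hΩ hbdd).ne'
  rw [Nat.cast_one, mul_one] at h1 h2
  rw [bergmanKernel, mul_eq_zero] at h
  rcases h with h | h
  · rw [h, pow_one, eq_comm, div_eq_zero_iff] at h1
    exact h1.resolve_right hkz
  · have : bergmanDiag 2 Ω z = 0 := by exact_mod_cast h
    linarith

theorem HolderOnWith.norm_sub_le {X : Type*} [SeminormedAddCommGroup X] {C α : ℝ≥0} {v : X → ℂ}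
    {s : Set X} (h : HolderOnWith C α v s) {x y : X} (hx : x ∈ s) (hy : y ∈ s) :
    ‖v x - v y‖ ≤ C * ‖x - y‖ ^ (α : ℝ) := by
  have := h.dist_le hx hy
  simpa [dist_eq_norm] using this

end

theorem theorem1p3 (n : ℕ) (Ω : Set (Fin n → ℂ))
    (hΩ_open : IsOpen Ω) (hΩ_conn : IsConnected Ω) (hΩ_bdd : Bornology.IsBounded Ω)
    (hΩ_reinhardt : IsCompleteReinhardt Ω) (hΩ_smooth : HasSmoothBoundary Ω)
    (hΩ_zero : ∃ ζ ∈ Ω, ∃ z ∈ Ω, bergmanKernel 2 Ω ζ z = 0) :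
    (∀ α : ℝ≥0, 0 < α → ∃ k : ℕ, 0 < k ∧ ∃ z ∈ Ω,
      ¬ MemHolderClosure α Ω (fun ζ => bergmanKernel (2 * (k : ℝ)) Ω ζ z)) ∧
    (∀ α : ℝ≥0, 0 < α → ∃ k : ℕ, 0 < k ∧
      ((∃ z ∈ Ω, ¬ MemContClosure Ω (fun ζ => bergmanKernel (2 * (k : ℝ)) Ω ζ z)) ∨
        -- all `K_{2k}(·, z)` extend continuously to the boundary, with values `Kbar ζ z` there
        (∃ Kbar : (Fin n → ℂ) → (Fin n → ℂ) → ℂ,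
          (∀ z ∈ Ω, IsContExtension Ω (fun ζ => bergmanKernel (2 * (k : ℝ)) Ω ζ z)
            (fun ζ => Kbar ζ z)) ∧
          ∃ ζ ∈ frontier Ω, ¬ MemHolderLoc α Ω (fun z => Kbar ζ z)))) := by
  obtain ⟨ζ₁, hζ₁, z₁, hz₁, hzero⟩ := hΩ_zero
  obtain ⟨κ, hκ⟩ := exists_isReproducingKernel hΩ_open hz₁
  have hbal := hΩ_reinhardt.balanced
  have hκ0 : κ 0 ≠ 0 := hκ.apply_zero_ne_zero hΩ_open hΩ_bdd hbal
  obtain ⟨t, ht, ht1, ζ₀, hζ₀, hκζ₀, hne⟩ := exists_first_zero hΩ_open hΩ_bdd hΩ_reinhardt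
    hκ.1.1.continuousOn hκ0
    ⟨ζ₁, hζ₁, hκ.apply_eq_zero_of_bergmanKernel hΩ_open hΩ_bdd hz₁ hζ₁ hzero⟩
  have hζ₀c : ζ₀ ∈ closure Ω := frontier_subset_closure hζ₀
  have hline : ∀ c : ℂ, ‖c‖ < 1 → c • ζ₀ ∈ Ω := fun c hc =>
    hΩ_reinhardt.smul_mem_of_mem_closure hc hζ₀c
  have hH : DifferentiableOn ℂ (fun c : ℂ => κ (c • ζ₀)) (Metric.ball 0 1) :=
    hκ.1.1.comp (f := fun c : ℂ => c • ζ₀) (by fun_prop) fun c hc => hline c (by simpa using hc)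
  have hH0 : (fun c : ℂ => κ (c • ζ₀)) 0 ≠ 0 := by simpa using hκ0
  have hnorm : ∀ s : ℝ, 0 < s → s < 1 → ‖(s : ℂ)‖ < 1 := fun s hs hs1 => by
    rwa [Complex.norm_real, Real.norm_of_nonneg hs.le]
  have hsz : ∀ s : ℝ, 0 < s → s < 1 → (s : ℂ) • z₁ ∈ Ω := fun s hs hs1 =>
    hbal.smul_mem (hnorm s hs hs1).le hz₁
  have hnear : ∀ᶠ s : ℝ in 𝓝[<] t, s ∈ Ioo 0 t := Ioo_mem_nhdsLT ht
  have hdiag : ∀ m : ℕ, 0 < m → ∀ s : ℝ, 0 < s → s < 1 →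
      (volume.real Ω)⁻¹ ≤ bergmanDiag (2 * (m : ℝ)) Ω ((s : ℂ) • z₁) := fun m hm s hs hs1 =>
    inv_volume_le_bergmanDiag hΩ_open hΩ_bdd (hsz s hs hs1) hm
  have hvol : 0 < (volume.real Ω)⁻¹ := inv_pos.2 (volume_real_pos hΩ_open hΩ_bdd ⟨z₁, hz₁⟩)
  refine ⟨fun α hα => ?_, fun α hα => ?_⟩
  · obtain ⟨m, hm, hnot⟩ := exists_not_eventually_le hH hH0 ht ht1
      (show (0 : ℝ) < α by exact_mod_cast hα)
    refine ⟨m, hm, (t : ℂ) • z₁, hsz t ht ht1, ?_⟩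
    rintro ⟨v, hvK, C, hvC⟩
    have hv := norm_pow_eq_of_isContExtension hΩ_open hΩ_bdd hΩ_reinhardt hz₁ hκ ht ht1
      (hne t ht.le le_rfl) hm ⟨hvC.continuousOn hα, hvK⟩
    set a := bergmanDiag (2 * (m : ℝ)) Ω ((t : ℂ) • z₁) ^ m / ‖κ ((t : ℂ) • (t : ℂ) • z₁)‖ with ha
    have hapos : 0 < a := div_pos (pow_pos (hvol.trans_le (hdiag m hm t ht ht1)) m)
      (norm_pos_iff.2 (hne t ht.le le_rfl _ (hsz t ht ht1)))
    have hv0 : v ζ₀ = 0 := by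
      have := hv ζ₀ hζ₀c
      rw [hκζ₀, norm_zero, mul_zero] at this
      exact norm_eq_zero.1 (pow_eq_zero_iff hm.ne' |>.1 this)
    -- Approach `ζ₀` along its radius: the kernel at `t z₁` takes at `(s / t) ζ₀` a value whose
    -- modulus to the power `m` is a multiple of `|κ(s ζ₀)|`.
    refine hnot (fun s => v (((s / t : ℝ) : ℂ) • ζ₀)) a (C * (t⁻¹ * ‖ζ₀‖) ^ (α : ℝ)) hapos ?_
    filter_upwards [hnear] with s hs
    have hst : s / t < 1 := (div_lt_one ht).2 hs.2
    have hmem := hline _ (hnorm (s / t) (div_pos hs.1 ht) hst)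
    refine ⟨?_, ?_⟩
    · rw [hv _ (subset_closure hmem), smul_smul, ← Complex.ofReal_mul, mul_div_cancel₀ _ ht.ne']
    · have h1 := hvC.norm_sub_le (subset_closure hmem) hζ₀c
      have h2 : ‖((s / t : ℝ) : ℂ) • ζ₀ - ζ₀‖ = t⁻¹ * ‖ζ₀‖ * (t - s) := by
        have h3 : ((s / t : ℝ) : ℂ) • ζ₀ - ζ₀ = ((s / t - 1 : ℝ) : ℂ) • ζ₀ := by
          rw [Complex.ofReal_sub, sub_smul, Complex.ofReal_one, one_smul]
        rw [h3, norm_smul, Complex.norm_real, Real.norm_eq_abs, abs_of_neg (by linarith)]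
        field_simp
        ring
      rw [hv0, sub_zero, h2, Real.mul_rpow (by positivity) (sub_nonneg.2 hs.2.le), ← mul_assoc]
        at h1
      exact h1
  · obtain ⟨m, hm, hnot⟩ := exists_not_eventually_le hH hH0 ht ht1
      (show (0 : ℝ) < α by exact_mod_cast hα)
    refine ⟨m, hm, or_iff_not_imp_left.2 fun hcont => ?_⟩
    push Not at hcont
    have hex : ∀ z, ∃ v, z ∈ Ω →
        IsContExtension Ω (fun ζ => bergmanKernel (2 * (m : ℝ)) Ω ζ z) v := fun z => by
      by_cases hz : z ∈ Ω
      · obtain ⟨v, hv⟩ := hcont z hz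
        exact ⟨v, fun _ => hv⟩
      · exact ⟨0, fun h => absurd h hz⟩
    choose V hV using hex
    refine ⟨fun ζ z => V z ζ, hV, ζ₀, hζ₀, fun hloc => ?_⟩
    obtain ⟨U, hU, C, hUC⟩ := hloc _ (hsz t ht ht1)
    rw [hΩ_open.nhdsWithin_eq (hsz t ht ht1)] at hU
    have hval : ∀ s : ℝ, 0 < s → s ≤ t → ‖V ((s : ℂ) • z₁) ζ₀‖ ^ m =
        bergmanDiag (2 * (m : ℝ)) Ω ((s : ℂ) • z₁) ^ m / ‖κ ((s : ℂ) • (s : ℂ) • z₁)‖ *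
          ‖κ ((s : ℂ) • ζ₀)‖ := fun s hs hst =>
      norm_pow_eq_of_isContExtension hΩ_open hΩ_bdd hΩ_reinhardt hz₁ hκ hs (hst.trans_lt ht1)
        (hne s hs.le hst) hm (hV _ (hsz s hs (hst.trans_lt ht1))) ζ₀ hζ₀c
    have hV0 : V ((t : ℂ) • z₁) ζ₀ = 0 := by
      have := hval t ht le_rfl
      rw [hκζ₀, norm_zero, mul_zero] at this
      exact norm_eq_zero.1 (pow_eq_zero_iff hm.ne' |>.1 this)
    -- The factor in `hval` is bounded below near `t`: its denominator stays below `M`.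
    set M := ‖κ ((t : ℂ) • (t : ℂ) • z₁)‖ + 1 with hM
    have hMpos : 0 < M := by positivity
    have hUev : ∀ᶠ s : ℝ in 𝓝[<] t, (s : ℂ) • z₁ ∈ U := by
      have h1 : Continuous fun s : ℝ => (s : ℂ) • z₁ := by fun_prop
      exact (h1.continuousAt.eventually hU).filter_mono nhdsWithin_le_nhds
    have hMev : ∀ᶠ s : ℝ in 𝓝[<] t, ‖κ ((s : ℂ) • (s : ℂ) • z₁)‖ < M := by
      have h1 : Continuous fun s : ℝ => (s : ℂ) • (s : ℂ) • z₁ := by fun_prop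
      have h2 : ContinuousAt κ ((t : ℂ) • (t : ℂ) • z₁) := hκ.1.1.continuousOn.continuousAt
        (hΩ_open.mem_nhds (hbal.smul_mem (hnorm t ht ht1).le (hsz t ht ht1)))
      have h3 : ContinuousAt (fun s : ℝ => ‖κ ((s : ℂ) • (s : ℂ) • z₁)‖) t :=
        (ContinuousAt.comp (f := fun s : ℝ => (s : ℂ) • (s : ℂ) • z₁) h2 h1.continuousAt).norm
      exact (h3.eventually (gt_mem_nhds (lt_add_one _))).filter_mono nhdsWithin_le_nhds
    -- Here the first variable stays at `ζ₀` and the pole `s z₁` moves to `t z₁`; by the symmetry of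
    -- `K₂` the same function `κ(s ζ₀)` governs the decay.
    refine hnot (fun s => V ((s : ℂ) • z₁) ζ₀) ((volume.real Ω)⁻¹ ^ m / M)
      (C * ‖z₁‖ ^ (α : ℝ)) (by positivity) ?_
    filter_upwards [hnear, hUev, hMev] with s hs hsU hsM
    have hs1 := hs.2.trans ht1
    have hκpos : 0 < ‖κ ((s : ℂ) • (s : ℂ) • z₁)‖ :=
      norm_pos_iff.2 (hne s hs.1.le hs.2.le _ (hsz s hs.1 hs1))
    refine ⟨?_, ?_⟩
    · rw [hval s hs.1 hs.2.le]
      have hle := hdiag m hm s hs.1 hs1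
      have hnonneg := hvol.le.trans hle
      gcongr
    · have h1 := hUC.norm_sub_le hsU (mem_of_mem_nhds hU)
      simp only at h1
      have h2 : ‖(s : ℂ) • z₁ - (t : ℂ) • z₁‖ = ‖z₁‖ * (t - s) := by
        rw [← sub_smul, norm_smul, ← Complex.ofReal_sub, Complex.norm_real, Real.norm_eq_abs,
          abs_sub_comm, abs_of_pos (sub_pos.2 hs.2), mul_comm]
      rw [hV0, sub_zero, h2, Real.mul_rpow (norm_nonneg _) (sub_nonneg.2 hs.2.le), ← mul_assoc]
        at h1
      exact h1
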